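/- Let $N\ge 3$, $2^*=\frac{2N}{N-2}$, and let $f:\mathbb R\to\mathbb R$ be the unique solution of $f'(t)=\frac{1}{\sqrt{1+2f(t)^2}}$ for $t\in\mathbb R$, $f(0)=0$. Let $D^{1,2}_r(\mathbb R^N)$ be the closure of the radial functions of $C_c^\infty(\mathbb R^N)$ in $\{u\in L^{2^*}(\mathbb R^N):\nabla u\in L^2(\mathbb R^N)\}$ with respect to $\|u\|_{1,2}=\big(\int_{\mathbb R^N}|\nabla u|^2dx\big)^{1/2}$. Let $V:(0,\infty)\to[0,\infty)$ and $K:(0,\infty)\to(0,\infty)$ be continuous, and suppose that for some $C_0>0$ one has $V(r)\le C_0/r^2$ for all $r\in(0,1)$. Put $$E=\Big\{u\in D^{1,2}_r(\mathbb R^N):\int_{\mathbb R^N}V(|x|)f(u)^2dx<\infty\Big\},\qquad \|u\|=\|u\|_{1,2}+\inf_{k>0}\frac1k\Big[1+\int_{\mathbb R^N}V(|x|)f(ku)^2dx\Big],$$ and, for $q>1$ and $R>0$, with $B_R=\{x\in\mathbb R^N:|x|<R\}$, $$\mathcal S_\infty(q,R)=\sup_{u\in E,\ \|u\|=1}\int_{\mathbb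 R^N\setminus B_R}K(|x|)|u|^q\,dx\in[0,\infty].$$ For $\alpha\in\mathbb R$ and $\beta\in[0,1]$ let $q_\infty^*(\alpha,\beta)=2\,\frac{\alpha+N-2\beta}{N-2}$. Theorem. Assume that there are $R_2>0$, $\beta_\infty\in[0,1]$ and $\alpha_\infty\in\mathbb R$ such that $$\sup_{r>R_2}\frac{K(r)}{r^{\alpha_\infty}V(r)^{\beta_\infty}}<+\infty,$$ where $V(r)^0=1$ for every $r$, and the quotient is $+\infty$ if $V(r)=0$ and $\beta_\infty>0$. Then for every real $q_2>\max\{1,\,2\beta_\infty,\,q_\infty^*(\alpha_\infty,\beta_\infty)\}$ one has $$\lim_{R\to+\infty}\mathcal S_\infty(q_2,R)=0.$$ More precisely, there are $\delta<0$, depending only on $N,\alpha_\infty,\beta_\infty,q_2$, and a constant $C$ independent of $R$, such that $\mathcal S_\infty(q_2,R)\le C R^{\delta}$ for all $R>R_2$. -/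

import Mathlib

open MeasureTheory Filter Set
open scoped Topology ENNReal ContDiff

namespace QuasilinearSchrodinger

/-! ### The change of variable -/

/-- `f` solves the Cauchy problem `f' = 1 / √(1 + 2 f²)` on `ℝ`, `f 0 = 0`. -/
def SolvesCauchy (f : ℝ → ℝ) : Prop :=
  f 0 = 0 ∧ ∀ t, HasDerivAt f (1 / Real.sqrt (1 + 2 * f t ^ 2)) t

theorem existsUnique_solvesCauchy : ∃! f : ℝ → ℝ, SolvesCauchy f := by
  have hpos : ∀ s : ℝ, 0 < Real.sqrt (1 + 2 * s ^ 2) := fun s => Real.sqrt_pos.2 (by positivity)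
  have hcont : Continuous fun s : ℝ => Real.sqrt (1 + 2 * s ^ 2) := by fun_prop
  let F : ℝ → ℝ := fun t => ∫ s in (0 : ℝ)..t, Real.sqrt (1 + 2 * s ^ 2)
  have hF0 : F 0 = 0 := intervalIntegral.integral_same
  have hF : ∀ t, HasDerivAt F (Real.sqrt (1 + 2 * t ^ 2)) t := fun t =>
    intervalIntegral.integral_hasDerivAt_right (hcont.intervalIntegrable _ _)
      (hcont.stronglyMeasurableAtFilter _ _) hcont.continuousAt
  have hFc : Continuous F := continuous_iff_continuousAt.2 fun t => (hF t).continuousAt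
  have hmono : StrictMono F := strictMono_of_deriv_pos fun t => by
    rw [(hF t).deriv]; exact hpos t
  have hsub : Monotone fun t => F t - t := by
    refine monotone_of_deriv_nonneg
      (fun t => ((hF t).sub (hasDerivAt_id t)).differentiableAt) fun t => ?_
    have h1 : (1 : ℝ) ≤ Real.sqrt (1 + 2 * t ^ 2) := Real.one_le_sqrt.2 (by nlinarith [sq_nonneg t])
    have h2 := ((hF t).sub (hasDerivAt_id t)).deriv
    have h3 : deriv (fun t => F t - t) t = Real.sqrt (1 + 2 * t ^ 2) - 1 := h2
    rw [h3]; linarith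
  have htop : Tendsto F atTop atTop := by
    refine tendsto_atTop_mono' _ ?_ tendsto_id
    filter_upwards [eventually_ge_atTop 0] with t ht
    have := hsub ht
    simp only [hF0] at this
    simpa using (by linarith : t ≤ F t)
  have hbot : Tendsto F atBot atBot := by
    refine tendsto_atBot_mono' _ ?_ tendsto_id
    filter_upwards [eventually_le_atBot 0] with t ht
    have := hsub ht
    simp only [hF0] at this
    simpa using (by linarith : F t ≤ t)
  let e : ℝ ≃o ℝ := hmono.orderIsoOfSurjective F (hFc.surjective htop hbot)
  have he : ∀ x, e x = F x := fun _ => rfl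
  refine ⟨e.symm, ⟨?_, fun t => ?_⟩, fun g hg => ?_⟩
  · rw [OrderIso.symm_apply_eq, he, hF0]
  · rw [one_div]
    refine HasDerivAt.of_local_left_inverse (f := F) e.symm.continuous.continuousAt
      (hF _) (hpos _).ne' (Eventually.of_forall fun y => ?_)
    rw [← he, OrderIso.apply_symm_apply]
  · have hd : ∀ t, HasDerivAt (fun t => F (g t) - t) 0 t := fun t => by
      have h := ((hF (g t)).comp t (hg.2 t)).sub (hasDerivAt_id t)
      have h0 : Real.sqrt (1 + 2 * g t ^ 2) * (1 / Real.sqrt (1 + 2 * g t ^ 2)) - 1 = 0 := by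
        rw [mul_one_div_cancel (hpos _).ne', sub_self]
      rw [h0] at h
      exact h
    funext t
    have h := is_const_of_deriv_eq_zero (fun t => (hd t).differentiableAt)
      (fun t => (hd t).deriv) t 0
    simp only [hg.1, hF0, sub_zero] at h
    rw [eq_comm, OrderIso.symm_apply_eq, he]
    linarith

/-- The unique solution of the Cauchy problem. -/
noncomputable def changeVar : ℝ → ℝ := existsUnique_solvesCauchy.choose

theorem changeVar_spec : SolvesCauchy changeVar := existsUnique_solvesCauchy.choose_spec.1

/-! ### Potentials -/

/-- The standing hypothesis on the potentials; only their values on `(0, ∞)` matter. -/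
structure Potentials (V K : ℝ → ℝ) : Prop where
  continuousOn_V : ContinuousOn V (Ioi 0)
  nonneg_V : ∀ r, 0 < r → 0 ≤ V r
  continuousOn_K : ContinuousOn K (Ioi 0)
  pos_K : ∀ r, 0 < r → 0 < K r
  bound_V : ∃ C : ℝ, 0 < C ∧ ∀ r ∈ Ioo (0 : ℝ) 1, V r ≤ C / r ^ 2

/-! ### Function spaces -/

/-- `G` is the weak (distributional) gradient of `u` on `ℝ^N`. -/
def IsWeakGradient {N : ℕ} (u : EuclideanSpace ℝ (Fin N) → ℝ)
    (G : EuclideanSpace ℝ (Fin N) → EuclideanSpace ℝ (Fin N)) : Prop :=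
  LocallyIntegrable u ∧ LocallyIntegrable G ∧
    ∀ φ : EuclideanSpace ℝ (Fin N) → ℝ, ContDiff ℝ ∞ φ → HasCompactSupport φ →
      ∫ x, u x • gradient φ x = - ∫ x, φ x • G x

/-- `‖u‖_{1,2}`, the `L²` norm of the weak gradient. The weak gradient is unique up to null sets, so
the infimum is over one class of functions (and it is `∞` when there is no weak gradient). -/
noncomputable def gradNorm {N : ℕ} (u : EuclideanSpace ℝ (Fin N) → ℝ) : ℝ≥0∞ :=
  ⨅ (G : EuclideanSpace ℝ (Fin N) → EuclideanSpace ℝ (Fin N)) (_ : IsWeakGradient u G),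
    eLpNorm G 2 volume

/-- Radial functions in `C_c^∞(ℝ^N)`. -/
def IsRadialTest {N : ℕ} (φ : EuclideanSpace ℝ (Fin N) → ℝ) : Prop :=
  ContDiff ℝ ∞ φ ∧ HasCompactSupport φ ∧ ∀ x y, ‖x‖ = ‖y‖ → φ x = φ y

/-- The critical Sobolev exponent `2N / (N - 2)` (used for `N ≥ 3`). -/
noncomputable def sobolevExp (N : ℕ) : ℝ≥0∞ := ENNReal.ofReal (2 * N / ((N : ℝ) - 2))

/-- Membership in `D_r^{1,2}(ℝ^N)`, `N ≥ 3`: the closure of the radial test functions in the norm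
`‖∇u‖_{L²}`, taken inside `{u ∈ L^{2*} : ∇u ∈ L²}`. By the Sobolev inequality, convergence of the
gradients in `L²` entails the convergence in `L^{2*}` that is recorded along with it. -/
def MemDr {N : ℕ} (u : EuclideanSpace ℝ (Fin N) → ℝ) : Prop :=
  MemLp u (sobolevExp N) volume ∧
  ∃ G : EuclideanSpace ℝ (Fin N) → EuclideanSpace ℝ (Fin N),
    IsWeakGradient u G ∧ MemLp G 2 volume ∧
    ∃ φ : ℕ → EuclideanSpace ℝ (Fin N) → ℝ, (∀ n, IsRadialTest (φ n)) ∧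
      Tendsto (fun n => eLpNorm (fun x => G x - gradient (φ n) x) 2 volume) atTop (𝓝 0) ∧
      Tendsto (fun n => eLpNorm (fun x => u x - φ n x) (sobolevExp N) volume) atTop (𝓝 0)

/-- The modular `∫ V(|x|) f(u)² dx`. -/
noncomputable def modular {N : ℕ} (V : ℝ → ℝ) (u : EuclideanSpace ℝ (Fin N) → ℝ) : ℝ≥0∞ :=
  ∫⁻ x, ENNReal.ofReal (V ‖x‖ * changeVar (u x) ^ 2)

/-- Membership in the space `E`. -/
def MemE {N : ℕ} (V : ℝ → ℝ) (u : EuclideanSpace ℝ (Fin N) → ℝ) : Prop :=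
  MemDr u ∧ modular V u < ⊤

/-- The Orlicz norm `inf_{k > 0} (1/k) (1 + ∫ V(|x|) f(k u)² dx)`. -/
noncomputable def orliczNorm {N : ℕ} (V : ℝ → ℝ) (u : EuclideanSpace ℝ (Fin N) → ℝ) : ℝ≥0∞ :=
  ⨅ (k : ℝ) (_ : 0 < k), ENNReal.ofReal (1 / k) * (1 + modular V (fun x => k * u x))

/-- The norm of `E`. -/
noncomputable def normE {N : ℕ} (V : ℝ → ℝ) (u : EuclideanSpace ℝ (Fin N) → ℝ) : ℝ≥0∞ :=
  gradNorm u + orliczNorm V u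

/-- `S_∞(q, R)`, the supremum of `∫_{|x| ≥ R} K(|x|) |u|^q dx` over the unit sphere of `E`. -/
noncomputable def SInfty (N : ℕ) (V K : ℝ → ℝ) (q R : ℝ) : ℝ≥0∞ :=
  ⨆ (u : EuclideanSpace ℝ (Fin N) → ℝ) (_ : MemE V u ∧ normE V u = 1),
    ∫⁻ x in (Metric.ball 0 R)ᶜ, ENNReal.ofReal (K ‖x‖ * |u x| ^ q)

/-- `q_∞^*(α, β) = 2 (α + N - 2β) / (N - 2)`. -/
noncomputable def qInftyStar (N : ℕ) (α β : ℝ) : ℝ := 2 * ((α + N - 2 * β) / ((N : ℝ) - 2))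

end QuasilinearSchrodinger

namespace QuasilinearSchrodinger

/-! ### Growth of the change of variable -/

/-! On the unit sphere of `E` both parts of the norm are at most 1. The gradient part gives the
radial decay `|u x| ≤ c ‖x‖ ^ (-(N - 2) / 2)` (`MemDr.exists_abs_le`), so `u` is uniformly bounded
outside `B_{R₂}`. On bounded sets `f(s)²` is comparable to `s²`, hence the Orlicz part bounds `∫ V
u²` there (`exists_lintegral_mul_sq_le`).

Since `K ≤ Λ r^α V^β`, it remains to write `|u|^q = (u²)^β |u|^(q - 2β)` and apply the decay to the
last factor. This leaves `(V u²)^β` times the power `2η - N(1 - β)` of `‖x‖`, where `2η = α + N - 2β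
- (N - 2)q/2`, and `η < 0` exactly when `q > q_∞^*`. One `η` is spent on the factor `R^η`. The other
makes Hölder's inequality with exponents `1/β` and `1/(1 - β)` converge at infinity. Thus `δ = η`.
-/

theorem deriv_changeVar (t : ℝ) : deriv changeVar t = 1 / Real.sqrt (1 + 2 * changeVar t ^ 2) :=
  (changeVar_spec.2 t).deriv

theorem differentiable_changeVar : Differentiable ℝ changeVar :=
  fun t => (changeVar_spec.2 t).differentiableAt

theorem deriv_changeVar_pos (t : ℝ) : 0 < deriv changeVar t := by
  rw [deriv_changeVar]; positivity

theorem monotone_changeVar : Monotone changeVar :=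
  (strictMono_of_deriv_pos deriv_changeVar_pos).monotone

/-- Mean value theorem from `f 0 = 0`. Both comparisons of `f(t)²` with `t²` follow, because `f'(s)²
(1 + 2 f(s)²) = 1`. -/
theorem exists_changeVar_eq_mul_deriv (t : ℝ) :
    ∃ s, |s| ≤ |t| ∧ changeVar t = t * deriv changeVar s := by
  have hc : ∀ s : Set ℝ, ContinuousOn changeVar s :=
    fun s => differentiable_changeVar.continuous.continuousOn
  have hd : ∀ s : Set ℝ, DifferentiableOn ℝ changeVar s :=
    fun s => differentiable_changeVar.differentiableOn
  rcases lt_trichotomy t 0 with ht | rfl | ht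
  · obtain ⟨s, hs, h⟩ := exists_deriv_eq_slope changeVar ht (hc _) (hd _)
    refine ⟨s, ?_, ?_⟩
    · rw [abs_of_neg hs.2, abs_of_neg ht]; linarith [hs.1]
    · rw [h, changeVar_spec.1]; field_simp; ring
  · exact ⟨0, le_rfl, by rw [changeVar_spec.1]; ring⟩
  · obtain ⟨s, hs, h⟩ := exists_deriv_eq_slope changeVar ht (hc _) (hd _)
    refine ⟨s, ?_, ?_⟩
    · rw [abs_of_pos hs.1, abs_of_pos ht]; exact hs.2.le
    · rw [h, changeVar_spec.1]; field_simp; ring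

theorem sq_changeVar_le (t : ℝ) : changeVar t ^ 2 ≤ t ^ 2 := by
  obtain ⟨s, -, h⟩ := exists_changeVar_eq_mul_deriv t
  have h1 : deriv changeVar s ≤ 1 := by
    rw [deriv_changeVar, div_le_one (by positivity)]
    exact Real.one_le_sqrt.2 (by nlinarith [sq_nonneg (changeVar s)])
  have h2 : deriv changeVar s ^ 2 ≤ 1 := by nlinarith [deriv_changeVar_pos s]
  rw [h, mul_pow]
  nlinarith [sq_nonneg t]

theorem sq_le_mul_sq_changeVar {M t : ℝ} (ht : |t| ≤ M) :
    t ^ 2 ≤ (1 + 2 * M ^ 2) * changeVar t ^ 2 := by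
  obtain ⟨s, hs, h⟩ := exists_changeVar_eq_mul_deriv t
  have h1 : changeVar s ^ 2 ≤ M ^ 2 :=
    (sq_changeVar_le s).trans (sq_le_sq' (by linarith [neg_abs_le s]) (by linarith [le_abs_self s]))
  have h2 : deriv changeVar s ^ 2 * (1 + 2 * changeVar s ^ 2) = 1 := by
    rw [deriv_changeVar, div_pow, Real.sq_sqrt (by positivity)]
    field_simp
  rw [h, mul_pow]
  have h3 : 0 ≤ t ^ 2 * deriv changeVar s ^ 2 := by positivity
  calc t ^ 2 = (1 + 2 * changeVar s ^ 2) * (t ^ 2 * deriv changeVar s ^ 2) := by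
        linear_combination (-t ^ 2) * h2
    _ ≤ _ := by gcongr

/-- At `y = f(t)` this function is `(f²)'(t) = 2 f f'`. Its monotonicity, together with that of `f`,
makes `f²` convex. -/
theorem monotone_div_sqrt : Monotone fun y : ℝ => 2 * y * (1 / Real.sqrt (1 + 2 * y ^ 2)) := by
  have hpos : ∀ s : ℝ, 0 < 1 + 2 * s ^ 2 := fun s => by positivity
  have key : ∀ s : ℝ, HasDerivAt (fun y : ℝ => 2 * y * (1 / Real.sqrt (1 + 2 * y ^ 2)))
      (2 / ((1 + 2 * s ^ 2) * Real.sqrt (1 + 2 * s ^ 2))) s := fun s => by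
    have h1 : HasDerivAt (fun y : ℝ => 1 + 2 * y ^ 2) (4 * s) s := by
      have := ((hasDerivAt_pow 2 s).const_mul 2).const_add 1
      exact this.congr_deriv (by norm_num; ring)
    have h2 := ((hasDerivAt_id s).const_mul 2).div (h1.sqrt (hpos s).ne')
      (Real.sqrt_pos.2 (hpos s)).ne'
    have h3 : (fun y : ℝ => 2 * y * (1 / Real.sqrt (1 + 2 * y ^ 2))) =
        fun y : ℝ => (2 * id y) / Real.sqrt (1 + 2 * y ^ 2) := by
      funext y; simp [div_eq_mul_inv]
    rw [h3]
    refine h2.congr_deriv ?_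
    have h4 := Real.sq_sqrt (hpos s).le
    have h5 := Real.sqrt_pos.2 (hpos s)
    simp only [id]
    generalize Real.sqrt (1 + 2 * s ^ 2) = w at *
    rw [← h4]
    field_simp
    linear_combination 2 * h4
  refine monotone_of_deriv_nonneg (fun s => (key s).differentiableAt) fun s => ?_
  rw [(key s).deriv]
  have := hpos s
  positivity

theorem convexOn_sq_changeVar : ConvexOn ℝ univ fun t => changeVar t ^ 2 := by
  have hd : ∀ t, HasDerivAt (fun t => changeVar t ^ 2)
      (2 * changeVar t * (1 / Real.sqrt (1 + 2 * changeVar t ^ 2))) t := fun t => by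
    have h := (changeVar_spec.2 t).pow 2
    exact h.congr_deriv (by norm_num)
  refine Monotone.convexOn_univ_of_deriv (fun t => (hd t).differentiableAt) ?_
  have : deriv (fun t => changeVar t ^ 2) =
      fun t => 2 * changeVar t * (1 / Real.sqrt (1 + 2 * changeVar t ^ 2)) :=
    funext fun t => (hd t).deriv
  rw [this]
  exact monotone_div_sqrt.comp monotone_changeVar

theorem sq_changeVar_le_div {k : ℝ} (hk : 1 ≤ k) (t : ℝ) :
    changeVar t ^ 2 ≤ 1 / k * changeVar (k * t) ^ 2 := by
  have hk0 : 0 < k := by linarith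
  have h := (convexOn_sq_changeVar).2 (mem_univ (k * t)) (mem_univ 0)
    (by positivity : 0 ≤ 1 / k) (sub_nonneg.2 (by rw [div_le_one hk0]; exact hk)) (add_sub_cancel (1 / k) 1)
  simp only [smul_eq_mul, changeVar_spec.1, mul_zero, add_zero] at h
  have e : 1 / k * (k * t) = t := by field_simp
  rw [e] at h
  simpa using h

/-- Here `k` is a scale in the Orlicz norm, bounded below but not above. For `k ≥ 1`, convexity of
`f²` moves the scale out. For `k ≤ 1`, `k t` still lies in `[-M, M]`, and `1/k² ≤ 2/k`. -/
theorem sq_le_div_mul_sq_changeVar {M t k : ℝ} (ht : |t| ≤ M) (hk : 1 / 2 ≤ k) :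
    t ^ 2 ≤ 2 * (1 + 2 * M ^ 2) * (1 / k * changeVar (k * t) ^ 2) := by
  have hk0 : 0 < k := by linarith
  rcases le_total 1 k with h1 | h1
  · have h2 := sq_changeVar_le_div h1 t
    have h3 := sq_le_mul_sq_changeVar ht
    have h4 : 0 ≤ 1 / k * changeVar (k * t) ^ 2 := by positivity
    calc t ^ 2 ≤ (1 + 2 * M ^ 2) * changeVar t ^ 2 := h3
      _ ≤ (1 + 2 * M ^ 2) * (1 / k * changeVar (k * t) ^ 2) := by gcongr
      _ ≤ _ := by nlinarith [mul_nonneg (by positivity : 0 ≤ 1 + 2 * M ^ 2) h4]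
  · have h2 : |k * t| ≤ M := by
      rw [abs_mul, abs_of_pos hk0]
      exact (mul_le_of_le_one_left (abs_nonneg t) h1).trans ht
    have h3 := sq_le_mul_sq_changeVar h2
    have h4 : 0 ≤ (1 + 2 * M ^ 2) * changeVar (k * t) ^ 2 := by positivity
    have h5 : t ^ 2 ≤ 1 / k ^ 2 * ((1 + 2 * M ^ 2) * changeVar (k * t) ^ 2) := by
      rw [one_div, ← div_eq_inv_mul, le_div_iff₀ (by positivity)]
      linarith [mul_pow k t 2]
    have h6 : 1 / k ^ 2 ≤ 2 * (1 / k) := by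
      rw [div_le_iff₀ (by positivity)]; field_simp; linarith
    calc t ^ 2 ≤ 1 / k ^ 2 * ((1 + 2 * M ^ 2) * changeVar (k * t) ^ 2) := h5
      _ ≤ 2 * (1 / k) * ((1 + 2 * M ^ 2) * changeVar (k * t) ^ 2) := by gcongr
      _ = _ := by ring

/-! ### Pointwise decay of radial functions -/

/-- Write `g r = -∫ g'` over `[r, a]`, beyond which `g` vanishes, and split `|g'|` by a weighted
Young inequality. The bound is not homogeneous in `g`, which is harmless because it is used under a
bound on the gradient norm. -/
theorem abs_le_rpow_mul_integral_deriv_sq {N : ℕ} (hN : 3 ≤ N) {g : ℝ → ℝ} (hg : ContDiff ℝ 1 g)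
    {A : ℝ} (hA : ∀ t, A ≤ t → g t = 0)
    (hint : IntegrableOn (fun t => t ^ (N - 1) * deriv g t ^ 2) (Ioi 0)) {r : ℝ} (hr : 0 < r) :
    |g r| ≤ r ^ (-((N : ℝ) - 2) / 2) *
      ((∫ t in Ioi 0, t ^ (N - 1) * deriv g t ^ 2) + 1 / ((N : ℝ) - 2)) := by
  have hN' : (3 : ℝ) ≤ N := by exact_mod_cast hN
  set a := max A r with ha
  have hra : r ≤ a := le_max_right _ _
  have hdc : Continuous (deriv g) := hg.continuous_deriv le_rfl
  -- This weight balances the two terms: the tail of `t^(1 - N)` is of order `r^(2 - N) = ε²`, so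
  -- `ε⁻¹` times it is again of order `ε`.
  set ε : ℝ := r ^ (-((N : ℝ) - 2) / 2) with hε
  have hε0 : 0 < ε := Real.rpow_pos_of_pos hr _
  have hpos : ∀ t ∈ Icc r a, 0 < t := fun t ht => hr.trans_le ht.1
  have h0 : (0 : ℝ) ∉ uIcc r a := by rw [uIcc_of_le hra]; exact fun h => hr.not_ge h.1
  have hftc : ∫ t in r..a, deriv g t = - g r := by
    rw [intervalIntegral.integral_deriv_eq_sub
      (fun t _ => (hg.differentiable one_ne_zero) t) (hdc.intervalIntegrable _ _),
      hA a (le_max_left _ _), zero_sub]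
  have hi1 : IntervalIntegrable (fun t => ε * (t ^ (N - 1) * deriv g t ^ 2)) volume r a :=
    (by fun_prop : Continuous fun t => ε * (t ^ (N - 1) * deriv g t ^ 2)).intervalIntegrable _ _
  have hi2 : IntervalIntegrable (fun t : ℝ => ε⁻¹ * t ^ (1 - (N : ℝ))) volume r a :=
    (intervalIntegral.intervalIntegrable_rpow (Or.inr h0)).const_mul _
  have hpt : ∀ t ∈ Icc r a,
      |deriv g t| ≤ ε * (t ^ (N - 1) * deriv g t ^ 2) + ε⁻¹ * t ^ (1 - (N : ℝ)) := fun t ht => by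
    have ht0 := hpos t ht
    have e : t ^ (1 - (N : ℝ)) = (t ^ (N - 1))⁻¹ := by
      rw [← Real.rpow_natCast, ← Real.rpow_neg ht0.le]
      congr 1
      rw [Nat.cast_sub (by omega)]; push_cast; ring
    rw [e, ← mul_inv, ← mul_assoc]
    set w := ε * t ^ (N - 1) with hw
    have hw0 : 0 < w := by positivity
    rw [← sq_abs (deriv g t)]
    set y := |deriv g t|
    have e2 : w * y ^ 2 + w⁻¹ - y = w⁻¹ * ((w * y) ^ 2 + 1 - w * y) := by field_simp
    have e3 : 0 ≤ w⁻¹ * ((w * y) ^ 2 + 1 - w * y) := by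
      apply mul_nonneg (by positivity); nlinarith [sq_nonneg (w * y - 1 / 2)]
    linarith
  have hJ : ∫ t in r..a, t ^ (N - 1) * deriv g t ^ 2 ≤
      ∫ t in Ioi 0, t ^ (N - 1) * deriv g t ^ 2 := by
    rw [intervalIntegral.integral_of_le hra]
    refine setIntegral_mono_set hint ?_ (Ioc_subset_Ioi_self.trans (Ioi_subset_Ioi hr.le)).eventuallyLE
    filter_upwards [ae_restrict_mem measurableSet_Ioi] with t (ht : 0 < t)
    positivity
  have hW : ∫ t in r..a, t ^ (1 - (N : ℝ)) ≤ r ^ (2 - (N : ℝ)) * (1 / ((N : ℝ) - 2)) := by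
    rw [integral_rpow (Or.inr ⟨by linarith, h0⟩)]
    have e : 1 - (N : ℝ) + 1 = -((N : ℝ) - 2) := by ring
    have e' : 2 - (N : ℝ) = -((N : ℝ) - 2) := by ring
    rw [e, e', div_neg, ← neg_div, neg_sub, mul_one_div]
    have : 0 ≤ a ^ (-((N : ℝ) - 2)) := Real.rpow_nonneg (hr.le.trans hra) _
    gcongr <;> linarith
  have hεW : ε⁻¹ * (r ^ (2 - (N : ℝ)) * (1 / ((N : ℝ) - 2))) = ε * (1 / ((N : ℝ) - 2)) := by
    have : r ^ (2 - (N : ℝ)) = ε * ε := by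
      rw [hε, ← Real.rpow_add hr]; congr 1; ring
    rw [this]; field_simp
  calc |g r| = |∫ t in r..a, deriv g t| := by rw [hftc, abs_neg]
    _ ≤ ∫ t in r..a, |deriv g t| := intervalIntegral.abs_integral_le_integral_abs hra
    _ ≤ ∫ t in r..a, (ε * (t ^ (N - 1) * deriv g t ^ 2) + ε⁻¹ * t ^ (1 - (N : ℝ))) :=
        intervalIntegral.integral_mono_on hra (hdc.abs.intervalIntegrable _ _) (hi1.add hi2) hpt
    _ = ε * (∫ t in r..a, t ^ (N - 1) * deriv g t ^ 2) + ε⁻¹ * ∫ t in r..a, t ^ (1 - (N : ℝ)) := by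
        rw [intervalIntegral.integral_add hi1 hi2, intervalIntegral.integral_const_mul,
          intervalIntegral.integral_const_mul]
    _ ≤ ε * (∫ t in Ioi 0, t ^ (N - 1) * deriv g t ^ 2) +
        ε⁻¹ * (r ^ (2 - (N : ℝ)) * (1 / ((N : ℝ) - 2))) := by gcongr
    _ = _ := by rw [hεW]; ring

theorem continuous_gradient {F : Type*} [NormedAddCommGroup F] [InnerProductSpace ℝ F]
    [CompleteSpace F] {φ : F → ℝ} (hs : ContDiff ℝ 1 φ) : Continuous (gradient φ) :=
  (InnerProductSpace.toDual ℝ F).symm.continuous.comp (hs.continuous_fderiv one_ne_zero)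

theorem integrable_sq_norm_gradient {N : ℕ} {φ : EuclideanSpace ℝ (Fin N) → ℝ}
    (hs : ContDiff ℝ 1 φ) (hc : HasCompactSupport φ) :
    Integrable fun y => ‖gradient φ y‖ ^ 2 := by
  refine ((continuous_gradient hs).norm.pow 2).integrable_of_hasCompactSupport ?_
  have h := (hc.fderiv ℝ).comp_left
    (g := fun L => ‖(InnerProductSpace.toDual ℝ (EuclideanSpace ℝ (Fin N))).symm L‖ ^ 2) (by simp)
  exact h

/-- The `L²` norm of the gradient controls a radial test function pointwise away from the origin. -/
theorem IsRadialTest.exists_abs_le {N : ℕ} (hN : 3 ≤ N) : ∃ c : ℝ, 0 ≤ c ∧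
    ∀ φ : EuclideanSpace ℝ (Fin N) → ℝ, IsRadialTest φ → ∀ x, x ≠ 0 →
      |φ x| ≤ ‖x‖ ^ (-((N : ℝ) - 2) / 2) *
        (c * (∫ y, ‖gradient φ y‖ ^ 2) + 1 / ((N : ℝ) - 2)) := by
  have : NeZero N := ⟨by omega⟩
  have : Nontrivial (EuclideanSpace ℝ (Fin N)) := by
    have : Nonempty (Fin N) := ⟨0⟩
    infer_instance
  -- The area of the unit sphere, from integration in polar coordinates.
  set κ : ℝ := N * volume.real (Metric.ball (0 : EuclideanSpace ℝ (Fin N)) 1) with hκ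
  have hN' : (3 : ℝ) ≤ N := by exact_mod_cast hN
  have hκ0 : 0 < κ := by
    refine mul_pos (by linarith) (ENNReal.toReal_pos ?_ measure_ball_lt_top.ne)
    exact (Metric.measure_ball_pos volume _ one_pos).ne'
  refine ⟨κ⁻¹, by positivity, fun φ hφ x hx => ?_⟩
  obtain ⟨hs, hc, hrad⟩ := hφ
  set e : EuclideanSpace ℝ (Fin N) := ‖x‖⁻¹ • x with he
  have hx0 : 0 < ‖x‖ := norm_pos_iff.2 hx
  have he1 : ‖e‖ = 1 := by rw [he, norm_smul, norm_inv, norm_norm, inv_mul_cancel₀ hx0.ne']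
  set g : ℝ → ℝ := fun t => φ (t • e) with hg
  have hgs : ContDiff ℝ 1 g :=
    (hs.of_le (by exact_mod_cast le_top)).comp (contDiff_id.smul contDiff_const)
  have hdc : Continuous (deriv g) := hgs.continuous_deriv le_rfl
  have hφg : ∀ y, φ y = g ‖y‖ := fun y => hrad _ _ (by rw [norm_smul, he1]; simp)
  obtain ⟨A, hA⟩ := hc.isBounded.subset_ball (0 : EuclideanSpace ℝ (Fin N))
  have hne : ∀ᵐ y : EuclideanSpace ℝ (Fin N), y ≠ 0 := compl_mem_ae_iff.2 (measure_singleton 0)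
  have hzero : ∀ t, A ≤ t → g t = 0 := fun t ht => by
    by_contra hne
    have := hA (subset_tsupport φ hne)
    rw [mem_ball_zero_iff, norm_smul, he1, mul_one, Real.norm_eq_abs] at this
    linarith [le_abs_self t]
  have hle : ∀ y, y ≠ 0 → deriv g ‖y‖ ^ 2 ≤ ‖gradient φ y‖ ^ 2 := fun y hy => by
    have hy0 : 0 < ‖y‖ := norm_pos_iff.2 hy
    have hv : ‖‖y‖⁻¹ • y‖ = 1 := by rw [norm_smul, norm_inv, norm_norm, inv_mul_cancel₀ hy0.ne']
    -- By radiality the profile is the same along every ray, so `g'` at `‖y‖` is the derivative of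
    -- `φ` at `y` in the direction of `y` itself.
    have hgv : g = fun t => φ (t • ‖y‖⁻¹ • y) :=
      funext fun t => hrad _ _ (by rw [norm_smul t e, norm_smul t, he1, hv])
    have hd : HasDerivAt g (fderiv ℝ φ y (‖y‖⁻¹ • y)) ‖y‖ := by
      have h1 : HasDerivAt (fun t : ℝ => t • ‖y‖⁻¹ • y) (‖y‖⁻¹ • y) ‖y‖ := by
        simpa using (hasDerivAt_id ‖y‖).smul_const (‖y‖⁻¹ • y)
      have h2 : HasFDerivAt φ (fderiv ℝ φ y) (‖y‖ • ‖y‖⁻¹ • y) := by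
        rw [smul_inv_smul₀ hy0.ne']
        exact (hs.differentiable (by simp) y).hasFDerivAt
      rw [hgv]
      exact h2.comp_hasDerivAt _ h1
    rw [hd.deriv, ← sq_abs]
    gcongr
    have h3 := (fderiv ℝ φ y).le_opNorm (‖y‖⁻¹ • y)
    rwa [hv, mul_one, ← toDual_gradient, LinearIsometryEquiv.norm_map, toDual_gradient] at h3
  have hgi := integrable_sq_norm_gradient (hs.of_le (by exact_mod_cast le_top)) hc
  have hgi' : Integrable (fun y : EuclideanSpace ℝ (Fin N) => deriv g ‖y‖ ^ 2) := by
    refine hgi.mono' ((hdc.comp continuous_norm).pow 2).aestronglyMeasurable ?_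
    filter_upwards [hne] with y hy
    rw [Real.norm_of_nonneg (sq_nonneg _)]
    exact hle y hy
  have hint := (integrable_fun_norm_addHaar volume (f := fun t => deriv g t ^ 2)).1 hgi'
  have hval := integral_fun_norm_addHaar (volume : Measure (EuclideanSpace ℝ (Fin N))) (fun t => deriv g t ^ 2)
  simp only [finrank_euclideanSpace, Fintype.card_fin, smul_eq_mul, nsmul_eq_mul] at hint hval
  have h := abs_le_rpow_mul_integral_deriv_sq hN hgs hzero hint hx0
  rw [← hφg] at h
  refine h.trans ?_
  gcongr
  rw [← div_eq_inv_mul, le_div_iff₀ hκ0]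
  have hmono : ∫ y : EuclideanSpace ℝ (Fin N), deriv g ‖y‖ ^ 2 ≤ ∫ y, ‖gradient φ y‖ ^ 2 := by
    refine integral_mono_ae hgi' hgi ?_
    filter_upwards [hne] with y hy using hle y hy
  rw [hval] at hmono
  rw [hκ]
  linarith

theorem IsWeakGradient.ae_eq {N : ℕ} {u : EuclideanSpace ℝ (Fin N) → ℝ}
    {G G' : EuclideanSpace ℝ (Fin N) → EuclideanSpace ℝ (Fin N)}
    (h : IsWeakGradient u G) (h' : IsWeakGradient u G') : G =ᵐ[volume] G' := by
  refine ae_eq_of_integral_contDiff_smul_eq h.2.1 h'.2.1 fun φ hφ hc => ?_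
  have e := (h.2.2 φ hφ hc).symm.trans (h'.2.2 φ hφ hc)
  exact neg_injective e

theorem IsWeakGradient.gradNorm_eq {N : ℕ} {u : EuclideanSpace ℝ (Fin N) → ℝ}
    {G : EuclideanSpace ℝ (Fin N) → EuclideanSpace ℝ (Fin N)} (h : IsWeakGradient u G) :
    gradNorm u = eLpNorm G 2 volume :=
  le_antisymm (iInf₂_le G h) (le_iInf₂ fun _ h' => (eLpNorm_congr_ae (h.ae_eq h')).le)

theorem integral_sq_norm_le_of_eLpNorm_le {α F : Type*} [MeasurableSpace α] {μ : Measure α}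
    [NormedAddCommGroup F] {G : α → F} {C : ℝ} (hC : 0 ≤ C) (hG : AEStronglyMeasurable G μ)
    (h : eLpNorm G 2 μ ≤ ENNReal.ofReal C) : ∫ y, ‖G y‖ ^ 2 ∂μ ≤ C ^ 2 := by
  have hm : MemLp G 2 μ := ⟨hG, h.trans_lt ENNReal.ofReal_lt_top⟩
  rw [hm.eLpNorm_eq_integral_rpow_norm two_ne_zero ENNReal.ofNat_ne_top,
    ENNReal.ofReal_le_ofReal_iff hC] at h
  simp only [ENNReal.toReal_ofNat, Real.rpow_two] at h
  rw [← one_div, ← Real.sqrt_eq_rpow] at h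
  exact (Real.sqrt_le_left hC).1 h

/-- The decay passes from the approximating test functions to `u` along an almost everywhere
convergent subsequence. -/
theorem MemDr.exists_abs_le {N : ℕ} (hN : 3 ≤ N) : ∃ c : ℝ, 0 ≤ c ∧
    ∀ u : EuclideanSpace ℝ (Fin N) → ℝ, MemDr u → gradNorm u ≤ 1 →
      ∀ᵐ x, |u x| ≤ c * ‖x‖ ^ (-((N : ℝ) - 2) / 2) := by
  have hN' : (3 : ℝ) ≤ N := by exact_mod_cast hN
  obtain ⟨c, hc, hrad⟩ := IsRadialTest.exists_abs_le hN
  have hN2 : 0 ≤ 1 / ((N : ℝ) - 2) := one_div_nonneg.2 (by linarith)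
  -- Eventually `‖∇φ_n‖₂ ≤ ‖G‖₂ + 1 ≤ 2`.
  refine ⟨c * 2 ^ 2 + 1 / ((N : ℝ) - 2), by positivity, fun u hu hgu => ?_⟩
  obtain ⟨hLp, G, hG, hGm, φ, hφ, hφG, hφu⟩ := hu
  rw [hG.gradNorm_eq] at hgu
  have hexp : sobolevExp N ≠ 0 := by
    have : 0 < 2 * N / ((N : ℝ) - 2) := div_pos (by linarith) (by linarith)
    simpa [sobolevExp] using this
  have hgm : ∀ n, AEStronglyMeasurable (gradient (φ n)) volume := fun n =>
    (continuous_gradient ((hφ n).1.of_le (by exact_mod_cast le_top))).aestronglyMeasurable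
  have hmeas : TendstoInMeasure volume φ atTop u := by
    refine tendstoInMeasure_of_tendsto_eLpNorm hexp
      (fun n => (hφ n).1.continuous.aestronglyMeasurable) hLp.1 (hφu.congr fun n => ?_)
    exact eLpNorm_sub_comm u (φ n) _ _
  obtain ⟨ns, hns, hlim⟩ := hmeas.exists_seq_tendsto_ae
  have hbound : ∀ᶠ n in atTop, ∫ y, ‖gradient (φ n) y‖ ^ 2 ≤ (2 : ℝ) ^ 2 := by
    filter_upwards [hφG.eventually_le_const one_pos] with n hn
    refine integral_sq_norm_le_of_eLpNorm_le zero_le_two (hgm n) ?_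
    have e : gradient (φ n) = G - (fun x => G x - gradient (φ n) x) := by
      funext x; simp
    rw [e]
    refine (eLpNorm_sub_le hGm.1 (hGm.1.sub (hgm n)) one_le_two).trans ?_
    refine (add_le_add hgu hn).trans (le_of_eq ?_)
    norm_num
  have hne : ∀ᵐ y : EuclideanSpace ℝ (Fin N), y ≠ 0 := by
    have : Nontrivial (EuclideanSpace ℝ (Fin N)) := by
      have : Nonempty (Fin N) := ⟨⟨0, by omega⟩⟩
      infer_instance
    exact compl_mem_ae_iff.2 (measure_singleton 0)
  filter_upwards [hlim, hne] with x hx hx0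
  refine le_of_tendsto hx.abs ?_
  filter_upwards [hns.tendsto_atTop.eventually hbound] with n hn
  refine (hrad _ (hφ _) x hx0).trans ?_
  rw [mul_comm]
  gcongr

/-! ### The potential term of the norm -/

/-- The infimum need not be attained, but some `k` gives a value below 2. Each of the two summands
is then at most 2, and the first one, `1/k`, forces `k ≥ 1/2`. -/
theorem exists_scale_of_orliczNorm_le_one {N : ℕ} {V : ℝ → ℝ} {u : EuclideanSpace ℝ (Fin N) → ℝ}
    (h : orliczNorm V u ≤ 1) : ∃ k : ℝ, 1 / 2 ≤ k ∧
      ENNReal.ofReal (1 / k) * modular V (fun x => k * u x) ≤ 2 := by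
  have h2 : orliczNorm V u < 2 := h.trans_lt (by norm_num)
  rw [orliczNorm] at h2
  simp only [iInf_lt_iff] at h2
  obtain ⟨k, hk, hlt⟩ := h2
  rw [mul_add, mul_one] at hlt
  refine ⟨k, ?_, (le_add_self).trans hlt.le⟩
  have h3 : ENNReal.ofReal (1 / k) ≤ ENNReal.ofReal 2 := by
    refine (le_self_add.trans hlt.le).trans_eq (by simp)
  rw [ENNReal.ofReal_le_ofReal_iff zero_le_two, div_le_iff₀ hk] at h3
  linarith

theorem exists_lintegral_mul_sq_le {N : ℕ} (hN : 3 ≤ N) {R : ℝ} (hR : 0 < R) : ∃ C : ℝ≥0∞, C < ⊤ ∧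
    ∀ V : ℝ → ℝ, (∀ r, 0 < r → 0 ≤ V r) → ∀ u : EuclideanSpace ℝ (Fin N) → ℝ, MemDr u →
      normE V u ≤ 1 →
      ∫⁻ x in (Metric.ball 0 R)ᶜ, ENNReal.ofReal (V ‖x‖ * u x ^ 2) ≤ C := by
  have hN' : (3 : ℝ) ≤ N := by exact_mod_cast hN
  obtain ⟨c, hc, hdecay⟩ := MemDr.exists_abs_le hN
  set M := c * R ^ (-((N : ℝ) - 2) / 2)
  refine ⟨ENNReal.ofReal (2 * (1 + 2 * M ^ 2)) * 2,
    ENNReal.mul_lt_top ENNReal.ofReal_lt_top (by simp), fun V hV u hu hn => ?_⟩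
  obtain ⟨k, hk, hmod⟩ := exists_scale_of_orliczNorm_le_one (le_add_self.trans hn)
  have hk0 : 0 < k := by linarith
  calc ∫⁻ x in (Metric.ball 0 R)ᶜ, ENNReal.ofReal (V ‖x‖ * u x ^ 2)
      ≤ ∫⁻ x in (Metric.ball 0 R)ᶜ, ENNReal.ofReal (2 * (1 + 2 * M ^ 2)) *
          (ENNReal.ofReal (1 / k) * ENNReal.ofReal (V ‖x‖ * changeVar (k * u x) ^ 2)) := by
        refine setLIntegral_mono_ae' Metric.isOpen_ball.measurableSet.compl ?_
        filter_upwards [hdecay u hu (le_self_add.trans hn)] with x hx hxR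
        have hxR : R ≤ ‖x‖ := by simpa using hxR
        have hM : |u x| ≤ M := hx.trans <| mul_le_mul_of_nonneg_left
          (Real.rpow_le_rpow_of_nonpos hR hxR (by linarith)) hc
        rw [← ENNReal.ofReal_mul (by positivity), ← ENNReal.ofReal_mul (by positivity)]
        refine ENNReal.ofReal_le_ofReal ?_
        have := mul_le_mul_of_nonneg_left (sq_le_div_mul_sq_changeVar hM hk)
          (hV _ (hR.trans_le hxR))
        linarith
    _ ≤ ∫⁻ x, ENNReal.ofReal (2 * (1 + 2 * M ^ 2)) *
          (ENNReal.ofReal (1 / k) * ENNReal.ofReal (V ‖x‖ * changeVar (k * u x) ^ 2)) :=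
        setLIntegral_le_lintegral _ _
    _ = ENNReal.ofReal (2 * (1 + 2 * M ^ 2)) *
          (ENNReal.ofReal (1 / k) * modular V (fun x => k * u x)) := by
        rw [lintegral_const_mul' _ _ ENNReal.ofReal_ne_top,
          lintegral_const_mul' _ _ ENNReal.ofReal_ne_top, modular]
    _ ≤ _ := by gcongr

/-! ### Hölder's inequality against powers of the norm -/

theorem lintegral_rpow_norm_compl_ball_lt_top {N : ℕ} {R t : ℝ} (hR : 0 < R) (ht : (N : ℝ) < t) :
    ∫⁻ x in (Metric.ball (0 : EuclideanSpace ℝ (Fin N)) R)ᶜ, ENNReal.ofReal (‖x‖ ^ (-t)) < ⊤ := by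
  have ht0 : 0 < t := (Nat.cast_nonneg N).trans_lt ht
  have hint : Integrable fun x : EuclideanSpace ℝ (Fin N) => (1 + ‖x‖) ^ (-t) :=
    integrable_one_add_norm (by simpa using ht)
  refine lt_of_le_of_lt ?_ (hint.const_mul ((1 / R + 1) ^ t)).lintegral_lt_top
  refine le_trans ?_ (setLIntegral_le_lintegral (Metric.ball 0 R)ᶜ _)
  refine setLIntegral_mono' Metric.isOpen_ball.measurableSet.compl fun x hx => ?_
  have hxR : R ≤ ‖x‖ := by simpa using hx
  have hx0 : 0 < ‖x‖ := hR.trans_le hxR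
  refine ENNReal.ofReal_le_ofReal ?_
  have h1 : 1 + ‖x‖ ≤ (1 / R + 1) * ‖x‖ := by
    have : 1 ≤ 1 / R * ‖x‖ := by rw [one_div_mul_eq_div, le_div_iff₀ hR]; linarith
    linarith
  have h2 := Real.rpow_le_rpow_of_nonpos (by positivity) h1 (neg_nonpos.2 ht0.le)
  rw [Real.mul_rpow (by positivity) hx0.le, Real.rpow_neg (by positivity : 0 ≤ 1 / R + 1)] at h2
  rwa [inv_mul_le_iff₀ (by positivity)] at h2

theorem exists_lintegral_rpow_mul_rpow_norm_le {N : ℕ} {R β η : ℝ} (hR : 0 < R) (hβ0 : 0 ≤ β)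
    (hβ1 : β ≤ 1) (hη : η < 0) : ∃ D : ℝ≥0∞, D < ⊤ ∧ ∀ w : EuclideanSpace ℝ (Fin N) → ℝ≥0∞,
      AEMeasurable w (volume.restrict (Metric.ball 0 R)ᶜ) →
      ∫⁻ x in (Metric.ball 0 R)ᶜ, w x ^ β * ENNReal.ofReal (‖x‖ ^ (η - N * (1 - β))) ≤
        (∫⁻ x in (Metric.ball 0 R)ᶜ, w x) ^ β * D := by
  rcases hβ1.eq_or_lt with rfl | hβ1
  · refine ⟨ENNReal.ofReal (R ^ η), ENNReal.ofReal_lt_top, fun w hw => ?_⟩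
    simp only [ENNReal.rpow_one, sub_self, mul_zero, sub_zero]
    rw [← lintegral_mul_const' _ _ ENNReal.ofReal_ne_top]
    refine setLIntegral_mono' Metric.isOpen_ball.measurableSet.compl fun x hx => ?_
    have hxR : R ≤ ‖x‖ := by simpa using hx
    gcongr w x * ENNReal.ofReal ?_
    exact Real.rpow_le_rpow_of_nonpos hR hxR hη.le
  · have hβ : 0 < 1 - β := by linarith
    -- Chosen so that `(‖x‖^(-t))^(1 - β) = ‖x‖^(η - N(1 - β))`. The sign of `η` gives `t > N`,
    -- hence integrability at infinity. The case `β = 1` above has no second Hölder factor and uses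
    -- the supremum `R^η` instead.
    set t := (N : ℝ) - η / (1 - β) with ht
    have hNt : (N : ℝ) < t := by
      have := div_neg_of_neg_of_pos hη hβ
      linarith
    refine ⟨_, ENNReal.rpow_lt_top_of_nonneg hβ.le
      (lintegral_rpow_norm_compl_ball_lt_top hR hNt).ne, fun w hw => ?_⟩
    refine le_trans (le_of_eq ?_) (ENNReal.lintegral_mul_norm_pow_le hw
      (by fun_prop : Measurable fun x : EuclideanSpace ℝ (Fin N) =>
        ENNReal.ofReal (‖x‖ ^ (-t))).aemeasurable hβ0 hβ.le (by ring))
    refine lintegral_congr fun x => ?_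
    rw [ENNReal.ofReal_rpow_of_nonneg (by positivity) hβ.le, ← Real.rpow_mul (norm_nonneg x)]
    congr 4
    rw [ht]; field_simp; ring

/-! ### The tail estimate -/

theorem rpow_mul_rpow_mul_rpow_le {α β q n c v y r R η : ℝ} (hq : 2 * β ≤ q)
    (hβ0 : 0 ≤ β) (hc : 0 ≤ c) (hv : 0 ≤ v) (hR : 0 < R) (hr : R ≤ r) (hη : η ≤ 0)
    (hy : |y| ≤ c * r ^ (-(n - 2) / 2))
    (hexp : α + n - 2 * β - (n - 2) / 2 * q = 2 * η) :
    r ^ α * v ^ β * |y| ^ q ≤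
      c ^ (q - 2 * β) * R ^ η * ((v * y ^ 2) ^ β * r ^ (η - n * (1 - β))) := by
  have hr0 : 0 < r := hR.trans_le hr
  have h1 : |y| ^ q = (y ^ 2) ^ β * |y| ^ (q - 2 * β) := by
    rw [← sq_abs y, ← Real.rpow_natCast |y| 2, ← Real.rpow_mul (abs_nonneg y),
      ← Real.rpow_add_of_nonneg (abs_nonneg y) (by push_cast; linarith) (by linarith)]
    congr 1; push_cast; ring
  have h2 : |y| ^ (q - 2 * β) ≤ c ^ (q - 2 * β) * r ^ (-(n - 2) / 2 * (q - 2 * β)) := by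
    refine (Real.rpow_le_rpow (abs_nonneg y) hy (by linarith)).trans_eq ?_
    rw [Real.mul_rpow hc (by positivity), ← Real.rpow_mul hr0.le]
  -- The total power is `2η - n(1 - β)`. One `η` is split off to be bounded by `R^η`.
  have h3 : r ^ α * r ^ (-(n - 2) / 2 * (q - 2 * β)) = r ^ η * r ^ (η - n * (1 - β)) := by
    rw [← Real.rpow_add hr0, ← Real.rpow_add hr0]
    congr 1; linear_combination hexp
  have h4 : r ^ η ≤ R ^ η := Real.rpow_le_rpow_of_nonpos hR hr hη
  rw [Real.mul_rpow hv (sq_nonneg y), h1]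
  have hc' := Real.rpow_nonneg hc (q - 2 * β)
  calc r ^ α * v ^ β * ((y ^ 2) ^ β * |y| ^ (q - 2 * β))
      ≤ r ^ α * v ^ β * ((y ^ 2) ^ β * (c ^ (q - 2 * β) * r ^ (-(n - 2) / 2 * (q - 2 * β)))) := by
        gcongr
    _ = c ^ (q - 2 * β) * r ^ η * (v ^ β * (y ^ 2) ^ β * r ^ (η - n * (1 - β))) := by
        linear_combination (v ^ β * (y ^ 2) ^ β * c ^ (q - 2 * β)) * h3
    _ ≤ _ := by gcongr

theorem exists_SInfty_le {N : ℕ} (hN : 3 ≤ N) {α β q η : ℝ} (hβ0 : 0 ≤ β) (hβ1 : β ≤ 1)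
    (hqβ : 2 * β < q) (hη : η < 0)
    (hexp : α + N - 2 * β - ((N : ℝ) - 2) / 2 * q = 2 * η) {V K : ℝ → ℝ} (hVK : Potentials V K)
    {R₂ : ℝ} (hR₂ : 0 < R₂)
    (hsup : (⨆ r ∈ Ioi R₂, ENNReal.ofReal (K r) / ENNReal.ofReal (r ^ α * V r ^ β)) < ⊤) :
    ∃ C : ℝ, ∀ R : ℝ, R₂ < R → SInfty N V K q R ≤ ENNReal.ofReal (C * R ^ η) := by
  set Λ := ⨆ r ∈ Ioi R₂, ENNReal.ofReal (K r) / ENNReal.ofReal (r ^ α * V r ^ β) with hΛ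
  -- Finiteness of `Λ` rules out `V r = 0` when `β > 0`, since `K r > 0` would make the quotient
  -- `⊤`. For `β = 0` the convention `0 ^ 0 = 1` applies.
  have hK : ∀ r, R₂ < r → ENNReal.ofReal (K r) ≤ Λ * ENNReal.ofReal (r ^ α * V r ^ β) :=
    fun r hr => (ENNReal.div_le_iff_le_mul (Or.inr hsup.ne) (Or.inl ENNReal.ofReal_ne_top)).1
      (le_iSup₂ (f := fun r (_ : r ∈ Ioi R₂) =>
        ENNReal.ofReal (K r) / ENNReal.ofReal (r ^ α * V r ^ β)) r hr)
  obtain ⟨c, hc, hdecay⟩ := MemDr.exists_abs_le hN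
  obtain ⟨A, hA, hmod⟩ := exists_lintegral_mul_sq_le hN hR₂
  obtain ⟨D, hD, hholder⟩ := exists_lintegral_rpow_mul_rpow_norm_le (N := N) hR₂ hβ0 hβ1 hη
  set c' := c ^ (q - 2 * β) with hc'
  have hc'0 : 0 ≤ c' := Real.rpow_nonneg hc _
  have hB : Λ * ENNReal.ofReal c' * (A ^ β * D) ≠ ⊤ :=
    ENNReal.mul_ne_top (ENNReal.mul_ne_top hsup.ne ENNReal.ofReal_ne_top)
      (ENNReal.mul_ne_top (ENNReal.rpow_ne_top_of_nonneg hβ0 hA.ne) hD.ne)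
  refine ⟨(Λ * ENNReal.ofReal c' * (A ^ β * D)).toReal, fun R hR => ?_⟩
  have hR0 : 0 < R := hR₂.trans hR
  have hRη : 0 ≤ R ^ η := Real.rpow_nonneg hR0.le _
  rw [ENNReal.ofReal_mul ENNReal.toReal_nonneg, ENNReal.ofReal_toReal hB]
  refine iSup₂_le fun u ⟨hu, hn⟩ => ?_
  set w : EuclideanSpace ℝ (Fin N) → ℝ≥0∞ := fun x => ENNReal.ofReal (V ‖x‖ * u x ^ 2) with hw
  have hwm : AEMeasurable w (volume.restrict (Metric.ball 0 R₂)ᶜ) := by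
    have hVm : AEMeasurable (fun x : EuclideanSpace ℝ (Fin N) => V ‖x‖)
        (volume.restrict (Metric.ball 0 R₂)ᶜ) := by
      refine ContinuousOn.aemeasurable ?_ Metric.isOpen_ball.measurableSet.compl
      refine hVK.continuousOn_V.comp continuous_norm.continuousOn fun x hx => ?_
      exact hR₂.trans_le (by simpa using hx)
    exact (hVm.mul (hu.1.1.1.aemeasurable.restrict.pow_const 2)).ennreal_ofReal
  have hsub : (Metric.ball (0 : EuclideanSpace ℝ (Fin N)) R)ᶜ ⊆ (Metric.ball 0 R₂)ᶜ :=
    compl_subset_compl.2 (Metric.ball_subset_ball hR.le)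
  calc ∫⁻ x in (Metric.ball 0 R)ᶜ, ENNReal.ofReal (K ‖x‖ * |u x| ^ q)
      ≤ ∫⁻ x in (Metric.ball 0 R)ᶜ, Λ * ENNReal.ofReal (c' * R ^ η) *
          (w x ^ β * ENNReal.ofReal (‖x‖ ^ (η - N * (1 - β)))) := by
        refine setLIntegral_mono_ae' Metric.isOpen_ball.measurableSet.compl ?_
        filter_upwards [hdecay u hu.1 (le_self_add.trans hn.le)] with x hx hxR
        have hxR : R ≤ ‖x‖ := by simpa using hxR
        have hx0 : 0 < ‖x‖ := hR0.trans_le hxR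
        have hVx := hVK.nonneg_V _ hx0
        have hreal := rpow_mul_rpow_mul_rpow_le hqβ.le hβ0 hc hVx hR0 hxR hη.le hx hexp
        calc ENNReal.ofReal (K ‖x‖ * |u x| ^ q)
            = ENNReal.ofReal (K ‖x‖) * ENNReal.ofReal (|u x| ^ q) :=
              ENNReal.ofReal_mul (hVK.pos_K _ hx0).le
          _ ≤ Λ * ENNReal.ofReal (‖x‖ ^ α * V ‖x‖ ^ β) * ENNReal.ofReal (|u x| ^ q) := by
              gcongr
              exact hK _ (hR.trans_le hxR)
          _ = Λ * ENNReal.ofReal (‖x‖ ^ α * V ‖x‖ ^ β * |u x| ^ q) := by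
              rw [mul_assoc, ← ENNReal.ofReal_mul (by positivity)]
          _ ≤ Λ * ENNReal.ofReal (c' * R ^ η *
                ((V ‖x‖ * u x ^ 2) ^ β * ‖x‖ ^ (η - N * (1 - β)))) := by
              gcongr Λ * ENNReal.ofReal ?_
          _ = _ := by
              rw [ENNReal.ofReal_mul (mul_nonneg hc'0 hRη), mul_assoc,
                ENNReal.ofReal_mul (p := (V ‖x‖ * u x ^ 2) ^ β) (by positivity),
                ← ENNReal.ofReal_rpow_of_nonneg (by positivity) hβ0]
    _ = Λ * ENNReal.ofReal (c' * R ^ η) * ∫⁻ x in (Metric.ball 0 R)ᶜ,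
          w x ^ β * ENNReal.ofReal (‖x‖ ^ (η - N * (1 - β))) :=
        lintegral_const_mul' _ _ (ENNReal.mul_ne_top hsup.ne ENNReal.ofReal_ne_top)
    _ ≤ Λ * ENNReal.ofReal (c' * R ^ η) * (A ^ β * D) := by
        gcongr
        -- Enlarging the domain to the complement of `B_{R₂}` makes `A` and `D` independent of `R`.
        refine (lintegral_mono_set hsub).trans ((hholder w hwm).trans ?_)
        gcongr
        exact hmod V hVK.nonneg_V u hu.1 hn.le
    _ = _ := by rw [ENNReal.ofReal_mul hc'0]; ring

end QuasilinearSchrodinger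

theorem theorem3p3 (N : ℕ) (hN : 3 ≤ N) (α β q : ℝ) (hβ0 : 0 ≤ β) (hβ1 : β ≤ 1)
    (hq : max 1 (max (2 * β) (QuasilinearSchrodinger.qInftyStar N α β)) < q) :
    ∃ δ : ℝ, δ < 0 ∧
      ∀ V K : ℝ → ℝ, QuasilinearSchrodinger.Potentials V K →
      ∀ R₂ : ℝ, 0 < R₂ →
        (⨆ r ∈ Ioi R₂, ENNReal.ofReal (K r) / ENNReal.ofReal (r ^ α * V r ^ β)) < ⊤ →
        Tendsto (fun R : ℝ => QuasilinearSchrodinger.SInfty N V K q R) atTop (𝓝 0) ∧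
        ∃ C : ℝ, ∀ R : ℝ, R₂ < R →
          QuasilinearSchrodinger.SInfty N V K q R ≤ ENNReal.ofReal (C * R ^ δ) := by
  have hN' : (0 : ℝ) < (N : ℝ) - 2 := by
    have : (3 : ℝ) ≤ N := by exact_mod_cast hN
    linarith
  obtain ⟨-, hqβ, hqs⟩ : 1 < q ∧ 2 * β < q ∧ QuasilinearSchrodinger.qInftyStar N α β < q := by
    simpa using hq
  rw [QuasilinearSchrodinger.qInftyStar, ← mul_div_assoc, div_lt_iff₀ hN'] at hqs
  -- Half of the available exponent; its negativity is the condition `q > q_∞^*`.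
  set δ := (α + N - 2 * β - ((N : ℝ) - 2) / 2 * q) / 2 with hδ
  have hδ0 : δ < 0 := by rw [hδ]; linarith
  refine ⟨δ, hδ0, fun V K hVK R₂ hR₂ hsup => ?_⟩
  obtain ⟨C, hC⟩ := QuasilinearSchrodinger.exists_SInfty_le hN hβ0 hβ1 hqβ hδ0
    (by rw [hδ]; ring) hVK hR₂ hsup
  refine ⟨?_, C, hC⟩
  have hlim : Tendsto (fun R : ℝ => ENNReal.ofReal (C * R ^ δ)) atTop (𝓝 0) := by
    have h := (tendsto_rpow_neg_atTop (neg_pos.2 hδ0)).const_mul C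
    rw [neg_neg, mul_zero] at h
    simpa using ENNReal.tendsto_ofReal h
  refine tendsto_of_tendsto_of_tendsto_of_le_of_le' tendsto_const_nhds hlim
    (Eventually.of_forall fun _ => zero_le) ?_
  filter_upwards [eventually_gt_atTop R₂] with R hR using hC R hR
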